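/- Let $M$ be a smooth $m$-dimensional manifold (Hausdorff, second countable, without boundary), and let $\mathbf{T}M=TM\oplus T^*M$, with the neutral metric $g((X,\alpha),(Y,\mu))=\alpha(Y)+\mu(X)$ and the Courant bracket $$[(X,\alpha),(Y,\mu)]=\bigl([X,Y],\,L_X\mu-L_Y\alpha+\tfrac12 d(\alpha(Y)-\mu(X))\bigr)$$ on the space $\Gamma\mathbf{T}M$ of smooth sections. Let $\tau$ be a generalized 2-nilpotent structure, i.e. a smooth bundle endomorphism of $\mathbf{T}M$ of constant rank with $\tau^2=0$ and $g(\mathcal X,\tau\mathcal Y)+g(\tau\mathcal X,\mathcal Y)=0$. Let $E=\operatorname{im}\tau$, and let $\omega$ be the 2-form on $E$ defined by $\omega(e_1,e_2)=g(e_1,\mathcal X_2)$ for any $\mathcal X_2$ with $\tau\mathcal X_2=e_2$ (the value does not depend on the choice of $\mathcal X_2$). The Courant–Nijenhuis torsion of $\tau$ is $$\mathcal N_\tau(\mathcal X,\mathcal Y)=[\tau\mathcal X,\tau\mathcal Y]-\tau[\mathcal X,\tau\mathcal Y]-\tau[\tau\mathcal X,\mathcal Y]+\tau^2[\mathcal X,\mathcal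 Y].$$ If $\Gamma E$ is closed under the Courant bracket, then $E$ is regarded as a Lie algebroid (a standard fact) with this bracket and the anchor $\rho=pr_{TM}|_E$, and the exterior differential of a 2-form $\eta$ on $E$ is, for $a,b,c\in\Gamma E$, $$d_E\eta(a,b,c)=\rho(a)(\eta(b,c))-\rho(b)(\eta(a,c))+\rho(c)(\eta(a,b))-\eta([a,b],c)+\eta([a,c],b)-\eta([b,c],a).$$ A symplectic form of $E$ is a smooth, nondegenerate 2-form $\eta$ on $E$ (a section of $\wedge^2E^*$) with $d_E\eta=0$. Then $\mathcal N_\tau=0$ if and only if $\Gamma E$ is closed under the Courant bracket and $\omega$ is a symplectic form of the Lie algebroid $E$. Moreover, whenever $\Gamma E$ is closed under the Courant bracket, one has, for all $\mathcal X,\mathcal Y,\mathcal Z\in\Gamma\mathbf{T}M$, $$d_E\omega(\tau\mathcal X,\tau\mathcal Y,\tau\mathcal Z)=-g(\mathcal X,\mathcal N_\tau(\mathcal Y,\mathcal Z)).$$ -/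

import Mathlib

open Bundle VectorField
open scoped Manifold ContDiff Topology

noncomputable section

namespace BigTangent

/-! ### The big tangent bundle `TM ⊕ T*M` of an `m`-dimensional smooth manifold, and sections -/

section Bundles

/-- The model space `ℝᵐ`. -/
abbrev Mod (m : ℕ) : Type := EuclideanSpace ℝ (Fin m)

/-- The model fibre `ℝᵐ ⊕ (ℝᵐ)*` of the big tangent bundle. -/
abbrev BigMod (m : ℕ) : Type := Mod m × (Mod m →L[ℝ] ℝ)

variable (m : ℕ) (M : Type*) [TopologicalSpace M] [ChartedSpace (EuclideanSpace ℝ (Fin m)) M]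

/-- The tangent space `T_xM`. -/
abbrev Tan (x : M) : Type := TangentSpace (𝓡 m) x

/-- The cotangent space `T_x*M`. -/
abbrev Cot (x : M) : Type := Tan m M x →L[ℝ] ℝ

/-- The fibre `T_xM ⊕ T_x*M` of the big tangent bundle. -/
abbrev Big (x : M) : Type := Tan m M x × Cot m M x

variable [IsManifold (𝓡 m) ∞ M]

/-- Smooth functions on `M`. -/
abbrev SmoothFun := C^∞⟮𝓡 m, M; 𝓘(ℝ, ℝ), ℝ⟯

/-- Smooth vector fields on `M`. -/
abbrev VecField := Cₛ^∞⟮𝓡 m; Mod m, Tan m M⟯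

/-- Smooth differential 1-forms on `M`. -/
abbrev OneForm := Cₛ^∞⟮𝓡 m; Mod m →L[ℝ] ℝ, Cot m M⟯

/-- Smooth sections of the big tangent bundle. -/
abbrev BigSection := Cₛ^∞⟮𝓡 m; BigMod m, Big m M⟯

/-- Smooth vector bundle endomorphisms of the big tangent bundle. -/
abbrev BigEndo := Cₛ^∞⟮𝓡 m; BigMod m →L[ℝ] BigMod m, fun x : M => Big m M x →L[ℝ] Big m M x⟯

end Bundles

variable {m : ℕ} {M : Type*} [TopologicalSpace M] [ChartedSpace (EuclideanSpace ℝ (Fin m)) M]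
  [IsManifold (𝓡 m) ∞ M]

/-! ### Smoothness facts needed to build the operations on sections -/

section Smoothness

theorem contMDiffAt_pair {X : ∀ x : M, Tan m M x} {μ : ∀ x : M, Cot m M x} {x : M}
    (hμ : ContMDiffAt (𝓡 m) ((𝓡 m).prod 𝓘(ℝ, Mod m →L[ℝ] ℝ)) ∞
      (fun y => TotalSpace.mk' (Mod m →L[ℝ] ℝ) (E := Cot m M) y (μ y)) x)
    (hX : ContMDiffAt (𝓡 m) ((𝓡 m).prod 𝓘(ℝ, Mod m)) ∞
      (fun y => TotalSpace.mk' (Mod m) (E := Tan m M) y (X y)) x) :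
    ContMDiffAt (𝓡 m) 𝓘(ℝ, ℝ) ∞ (fun y => μ y (X y)) x :=
  (contMDiffAt_section x).1
    (ContMDiffAt.clm_bundle_apply (F₂ := ℝ) (E₂ := Bundle.Trivial M ℝ) hμ hX)

theorem mdifferentiableAt_pair {X : ∀ x : M, Tan m M x} {μ : ∀ x : M, Cot m M x} {x : M}
    (hμ : MDifferentiableAt (𝓡 m) ((𝓡 m).prod 𝓘(ℝ, Mod m →L[ℝ] ℝ))
      (fun y => TotalSpace.mk' (Mod m →L[ℝ] ℝ) (E := Cot m M) y (μ y)) x)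
    (hX : MDifferentiableAt (𝓡 m) ((𝓡 m).prod 𝓘(ℝ, Mod m))
      (fun y => TotalSpace.mk' (Mod m) (E := Tan m M) y (X y)) x) :
    MDifferentiableAt (𝓡 m) 𝓘(ℝ, ℝ) (fun y => μ y (X y)) x :=
  ((mdifferentiableAt_totalSpace _ _).1
    (MDifferentiableAt.clm_bundle_apply (F₂ := ℝ) (E₂ := Bundle.Trivial M ℝ) hμ hX)).2

theorem contMDiffAt_mvfderiv {f : M → ℝ} {X : ∀ x : M, Tan m M x} {x : M}
    (hf : ContMDiffAt (𝓡 m) 𝓘(ℝ, ℝ) ∞ f x)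
    (hX : ContMDiffAt (𝓡 m) ((𝓡 m).prod 𝓘(ℝ, Mod m)) ∞
      (fun y => TotalSpace.mk' (Mod m) (E := Tan m M) y (X y)) x) :
    ContMDiffAt (𝓡 m) 𝓘(ℝ, ℝ) ∞ (fun y => mvfderiv (𝓡 m) f y (X y)) x := by
  have h1 := hf.mfderiv_const (m := ∞) (by simp)
  have h2 := ContMDiffAt.clm_apply_of_inCoordinates (b₁ := id) (b₂ := f) h1 hX hf
  rw [contMDiffAt_totalSpace] at h2
  refine h2.2.congr_of_eventuallyEq (.of_forall fun y => ?_)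
  simp [mvfderiv]
  rfl

theorem contMDiffAt_mlieBracket {X Y : ∀ x : M, Tan m M x} {x : M}
    (hX : ContMDiffAt (𝓡 m) ((𝓡 m).prod 𝓘(ℝ, Mod m)) ∞
      (fun y => TotalSpace.mk' (Mod m) (E := Tan m M) y (X y)) x)
    (hY : ContMDiffAt (𝓡 m) ((𝓡 m).prod 𝓘(ℝ, Mod m)) ∞
      (fun y => TotalSpace.mk' (Mod m) (E := Tan m M) y (Y y)) x) :
    ContMDiffAt (𝓡 m) ((𝓡 m).prod 𝓘(ℝ, Mod m)) ∞
      (fun y => TotalSpace.mk' (Mod m) (E := Tan m M) y (mlieBracket (𝓡 m) X Y y)) x := by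
  have : IsManifold (𝓡 m) (minSmoothness ℝ 2) M := by
    rw [minSmoothness_of_isRCLikeNormedField]
    infer_instance
  have : IsManifold (𝓡 m) (((⊤ : ℕ∞) : WithTop ℕ∞) + 1) M := ‹IsManifold (𝓡 m) ∞ M›
  exact ContMDiffAt.mlieBracket_vectorField (n := ⊤) (m := ⊤) hX hY
    (by rw [minSmoothness_of_isRCLikeNormedField]; rfl)

/-- A field of covectors is smooth at `x` if its pairings with the vector fields that are smooth
near `x` are. -/
theorem contMDiffAt_oneForm {φ : ∀ x : M, Cot m M x} {x : M}
    (h : ∀ X : ∀ y : M, Tan m M y,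
      (∀ᶠ z in 𝓝 x, ContMDiffAt (𝓡 m) ((𝓡 m).prod 𝓘(ℝ, Mod m)) ∞
        (fun y => TotalSpace.mk' (Mod m) (E := Tan m M) y (X y)) z) →
      ContMDiffAt (𝓡 m) 𝓘(ℝ, ℝ) ∞ (fun y => φ y (X y)) x) :
    ContMDiffAt (𝓡 m) ((𝓡 m).prod 𝓘(ℝ, Mod m →L[ℝ] ℝ)) ∞
      (fun y => TotalSpace.mk' (Mod m →L[ℝ] ℝ) (E := Cot m M) y (φ y)) x := by
  rw [contMDiffAt_hom_bundle (E₂ := Bundle.Trivial M ℝ)]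
  refine ⟨contMDiffAt_id, ?_⟩
  let e := trivializationAt (Mod m) (Tan m M) x
  let b := (EuclideanSpace.basisFun (Fin m) ℝ).toBasis
  have hx : x ∈ e.baseSet := FiberBundle.mem_baseSet_trivializationAt (Mod m) (Tan m M) x
  have hb : ∀ᶠ y in 𝓝 x, y ∈ e.baseSet := e.open_baseSet.mem_nhds hx
  have key : ContMDiffAt (𝓡 m) 𝓘(ℝ, Mod m →L[ℝ] ℝ) ∞
      (fun y => ∑ i, (φ y (e.localFrame b i y)) • (EuclideanSpace.proj i : Mod m →L[ℝ] ℝ)) x := by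
    refine ContMDiffAt.sum fun i _ => ?_
    refine ContMDiffAt.smul (h _ ?_) contMDiffAt_const
    exact hb.mono fun z hz => contMDiffAt_localFrame_of_mem ∞ e b i hz
  refine key.congr_of_eventuallyEq (hb.mono fun y hy => ?_)
  apply ContinuousLinearMap.coe_injective
  refine b.ext fun j => ?_
  have hj : e.localFrame b j y = e.symmL ℝ y (b j) := by
    rw [Trivialization.localFrame_apply_of_mem_baseSet e b hy]
    simp [Trivialization.basisAt]
    exact (e.symmL_apply (R := ℝ) hy (b j)).symm
  have h1 : (∑ i, (φ y (e.localFrame b i y)) • (EuclideanSpace.proj i : Mod m →L[ℝ] ℝ)) (b j)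
      = φ y (e.localFrame b j y) := by
    simp only [sum_apply, smul_apply, smul_eq_mul]
    rw [Finset.sum_eq_single j (fun i _ hij => by simp [b, hij]) (by simp)]
    simp [b]
  refine Eq.trans ?_ h1.symm
  rw [hj]
  simp [e, ContinuousLinearMap.inCoordinates]

/-- The expression `X(μ(Z)) - μ([X, Z])` is function-linear in the vector field `Z`. -/
theorem tensorialAt_lieDeriv (X : ∀ x : M, Tan m M x) (μ : OneForm m M) (x : M) :
    TensorialAt (𝓡 m) (Mod m)
      (fun Z : ∀ x : M, Tan m M x =>
        mvfderiv (𝓡 m) (fun y => μ y (Z y)) x (X x) - μ x (mlieBracket (𝓡 m) X Z x)) x where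
  smul {f Z} hf hZ := by
    have := mvfderiv_fun_mul hf (mdifferentiableAt_pair μ.mdifferentiableAt hZ)
    simp [mlieBracket_smul_right hf hZ, this]
    ring
  add {Z Z'} hZ hZ' := by
    have := mvfderiv_fun_add (mdifferentiableAt_pair μ.mdifferentiableAt hZ)
      (mdifferentiableAt_pair μ.mdifferentiableAt hZ')
    simp [mlieBracket_add_right hZ hZ', this]
    ring

end Smoothness

/-! ### Operations on functions, vector fields and 1-forms -/

section Cartan

/-- The function `μ(X)`. -/
def pair (μ : OneForm m M) (X : VecField m M) : SmoothFun m M :=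
  ⟨fun x => μ x (X x), fun x => contMDiffAt_pair (μ.contMDiff x) (X.contMDiff x)⟩

/-- The differential `df` of a function. -/
def differential (f : SmoothFun m M) : OneForm m M :=
  ⟨fun x => mvfderiv (𝓡 m) f x, fun x => contMDiffAt_oneForm fun _ hX =>
    contMDiffAt_mvfderiv (f.contMDiff x) hX.self_of_nhds⟩

/-- The Lie bracket of vector fields. -/
def bracket (X Y : VecField m M) : VecField m M :=
  ⟨fun x => mlieBracket (𝓡 m) X Y x, fun x =>
    contMDiffAt_mlieBracket (X.contMDiff x) (Y.contMDiff x)⟩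

/-- The value at `x` of the Lie derivative `L_X μ`: the covector which maps `Z x` to
`X(μ(Z)) - μ([X, Z])` at `x`, for every vector field `Z` that is differentiable at `x`. -/
def lieDerivAt (X : VecField m M) (μ : OneForm m M) (x : M) : Cot m M x :=
  TensorialAt.mkHom (I := 𝓡 m) (F := Mod m) (V := Tan m M)
    (fun Z : ∀ x : M, Tan m M x =>
      mvfderiv (𝓡 m) (fun y => μ y (Z y)) x (X x) - μ x (mlieBracket (𝓡 m) X Z x)) x
    (tensorialAt_lieDeriv X μ x)

theorem lieDerivAt_apply (X : VecField m M) (μ : OneForm m M) {x : M} {Z : ∀ x : M, Tan m M x}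
    (hZ : MDifferentiableAt (𝓡 m) ((𝓡 m).prod 𝓘(ℝ, Mod m))
      (fun y => TotalSpace.mk' (Mod m) (E := Tan m M) y (Z y)) x) :
    lieDerivAt X μ x (Z x) =
      mvfderiv (𝓡 m) (fun y => μ y (Z y)) x (X x) - μ x (mlieBracket (𝓡 m) X Z x) :=
  TensorialAt.mkHom_apply (tensorialAt_lieDeriv X μ x) hZ

/-- The Lie derivative `L_X μ` of a 1-form. -/
def lieDeriv (X : VecField m M) (μ : OneForm m M) : OneForm m M :=
  ⟨fun x => lieDerivAt X μ x, fun x => contMDiffAt_oneForm fun Z hZ => by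
    have h1 : ContMDiffAt (𝓡 m) 𝓘(ℝ, ℝ) ∞ (fun y =>
        mvfderiv (𝓡 m) (fun y => μ y (Z y)) y (X y) - μ y (mlieBracket (𝓡 m) X Z y)) x :=
      (contMDiffAt_mvfderiv (contMDiffAt_pair (μ.contMDiff x) hZ.self_of_nhds)
        (X.contMDiff x)).sub
      (contMDiffAt_pair (μ.contMDiff x)
        (contMDiffAt_mlieBracket (X.contMDiff x) hZ.self_of_nhds))
    exact h1.congr_of_eventuallyEq
      (hZ.mono fun y hy => lieDerivAt_apply X μ (hy.mdifferentiableAt (by simp)))⟩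

end Cartan

/-! ### The neutral metric and the Courant bracket -/

section Courant

/-- The section `(X, α)` of the big tangent bundle. -/
def mkSection (X : VecField m M) (α : OneForm m M) : BigSection m M :=
  ⟨fun x => (X x, α x), fun x => (contMDiffAt_section x).2
    (((contMDiffAt_section x).1 (X.contMDiff x)).prodMk_space
      ((contMDiffAt_section x).1 (α.contMDiff x)))⟩

/-- The projection of a section `(X, α)` to the vector field `X`. -/
def prTan (s : BigSection m M) : VecField m M :=
  ⟨fun x => (s x).1, fun x => (contMDiffAt_section x).2
    (contDiff_fst.contMDiff.contMDiffAt.comp x ((contMDiffAt_section x).1 (s.contMDiff x)))⟩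

/-- The projection of a section `(X, α)` to the 1-form `α`. -/
def prCot (s : BigSection m M) : OneForm m M :=
  ⟨fun x => (s x).2, fun x => (contMDiffAt_section x).2
    ((contDiff_snd (E := Mod m)).contMDiff.contMDiffAt.comp x ((contMDiffAt_section x).1 (s.contMDiff x)))⟩

/-- The neutral metric `g((X, α), (Y, μ)) = α(Y) + μ(X)`, at a point. -/
def neutral {x : M} (u v : Big m M x) : ℝ := u.2 v.1 + v.2 u.1

/-- The Courant bracket
`[(X, α), (Y, μ)] = ([X, Y], L_X μ - L_Y α + (1/2) d(α(Y) - μ(X)))`. -/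
def courant (s t : BigSection m M) : BigSection m M :=
  mkSection (bracket (prTan s) (prTan t))
    (lieDeriv (prTan s) (prCot t) - lieDeriv (prTan t) (prCot s)
      + (1 / 2 : ℝ) • differential (pair (prCot s) (prTan t) - pair (prCot t) (prTan s)))

/-- The section `τ s`. -/
def apply (τ : BigEndo m M) (s : BigSection m M) : BigSection m M :=
  ⟨fun x => τ x (s x), τ.contMDiff.clm_bundle_apply s.contMDiff⟩

/-- The Courant-Nijenhuis torsion
`N_τ(s, t) = [τ s, τ t] - τ [s, τ t] - τ [τ s, t] + τ² [s, t]`. -/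
def torsion (τ : BigEndo m M) (s t : BigSection m M) : BigSection m M :=
  courant (apply τ s) (apply τ t) - apply τ (courant s (apply τ t))
    - apply τ (courant (apply τ s) t) + apply τ (apply τ (courant s t))

end Courant

/-! ### Generalized 2-nilpotent structures -/

section TwoNilpotent

/-- The fibre at `x` of the image `E = im τ`. -/
def image (τ : BigEndo m M) (x : M) : Submodule ℝ (Big m M x) :=
  LinearMap.range (τ x : Big m M x →ₗ[ℝ] Big m M x)

/-- Generalized 2-nilpotent structures: `τ² = 0`, `τ` is skew for the neutral metric, and `τ` has
constant rank. -/
structure IsTwoNilpotent (τ : BigEndo m M) : Prop where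
  sq_zero : ∀ (x : M) (u : Big m M x), τ x (τ x u) = 0
  skew : ∀ (x : M) (u v : Big m M x), neutral u (τ x v) + neutral (τ x u) v = 0
  const_rank : ∃ r : ℕ, ∀ x : M, Module.finrank ℝ (image τ x) = r

/-- Integrability of `τ`: the Courant-Nijenhuis torsion vanishes. -/
def IsIntegrable (τ : BigEndo m M) : Prop := ∀ s t : BigSection m M, torsion τ s t = 0

/-- The space `Γ E` of smooth sections of `E = im τ`. -/
def imageSections (τ : BigEndo m M) : Submodule ℝ (BigSection m M) where
  carrier := {s | ∀ x, s x ∈ image τ x}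
  add_mem' hs ht x := (image τ x).add_mem (hs x) (ht x)
  zero_mem' x := (image τ x).zero_mem
  smul_mem' c _ hs x := (image τ x).smul_mem c (hs x)

/-- The section `τ s` of `E = im τ`. -/
def applyImage (τ : BigEndo m M) (s : BigSection m M) : imageSections τ :=
  ⟨apply τ s, fun x => ⟨s x, rfl⟩⟩

/-- The value at `x` of a section of `E = im τ`. -/
def valueAt {τ : BigEndo m M} (a : imageSections τ) (x : M) : image τ x := ⟨a.1 x, a.2 x⟩

/-- Weak integrability of `τ`: `Γ E` is closed under the Courant bracket. -/
def IsWeaklyIntegrable (τ : BigEndo m M) : Prop :=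
  ∀ a ∈ imageSections τ, ∀ b ∈ imageSections τ, courant a b ∈ imageSections τ

/-- If `τ u = τ u'`, then `g(e, u) = g(e, u')` for all `e` in the image of `τ`. -/
theorem neutral_eq_of_apply_eq {τ : BigEndo m M} (hτ : IsTwoNilpotent τ) {x : M}
    {e : Big m M x} (he : e ∈ image τ x) {u u' : Big m M x} (h : τ x u = τ x u') :
    neutral e u = neutral e u' := by
  obtain ⟨w, rfl⟩ := he
  have h1 := hτ.skew x w u
  have h2 := hτ.skew x w u'
  rw [h] at h1
  exact add_left_cancel (h1.trans h2.symm)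

/-- The 2-form `ω` on `E = im τ`, given by `ω(e₁, e₂) = g(e₁, u₂)` for any `u₂` with
`τ u₂ = e₂`. -/
def omega {τ : BigEndo m M} (hτ : IsTwoNilpotent τ) (x : M) :
    LinearMap.BilinForm ℝ (image τ x) :=
  LinearMap.mk₂ ℝ (fun e₁ e₂ => neutral e₁.1 e₂.2.choose)
    (fun e e' f => by simp [neutral]; ring)
    (fun c e f => by simp [neutral]; ring)
    (fun e f f' => by
      have h : τ x (f + f').2.choose = τ x (f.2.choose + f'.2.choose) := by
        rw [(τ x).map_add]
        exact (f + f').2.choose_spec.trans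
          (congrArg₂ (· + ·) f.2.choose_spec f'.2.choose_spec).symm
      rw [neutral_eq_of_apply_eq hτ e.2 h]
      simp [neutral]; ring)
    (fun c e f => by
      have h : τ x (c • f).2.choose = τ x (c • f.2.choose) := by
        rw [(τ x).map_smul]
        exact (c • f).2.choose_spec.trans (congrArg (c • ·) f.2.choose_spec).symm
      rw [neutral_eq_of_apply_eq hτ e.2 h]
      simp [neutral]; ring)

/-- The form `ω` does not depend on the choice of the preimage. -/
theorem omega_apply {τ : BigEndo m M} (hτ : IsTwoNilpotent τ) {x : M} (e₁ e₂ : image τ x)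
    {u : Big m M x} (hu : τ x u = e₂.1) : omega hτ x e₁ e₂ = neutral e₁.1 u :=
  neutral_eq_of_apply_eq hτ e₁.2 (e₂.2.choose_spec.trans hu.symm)

end TwoNilpotent

/-! ### The Lie algebroid `E` of a weakly integrable structure -/

section Algebroid

variable {τ : BigEndo m M}

/-- The bracket of the Lie algebroid `E`: the restriction of the Courant bracket to `Γ E`. -/
def algBracket (h : IsWeaklyIntegrable τ) (a b : imageSections τ) : imageSections τ :=
  ⟨courant a b, h a a.2 b b.2⟩

/-- The anchor of the Lie algebroid `E`: the restriction of the projection to `TM`. -/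
def anchor (a : imageSections τ) : VecField m M := prTan a.1

/-- The evaluation `η(a, b)` of a field of bilinear forms on `E` on two sections of `E`. -/
def evalForm (η : ∀ x : M, LinearMap.BilinForm ℝ (image τ x)) (a b : imageSections τ) : M → ℝ :=
  fun x => η x (valueAt a x) (valueAt b x)

/-- The exterior differential `d_E η` of a 2-form `η` of the Lie algebroid `E`,
`d_E η(a, b, c) = ρ(a)(η(b, c)) - ρ(b)(η(a, c)) + ρ(c)(η(a, b))
  - η([a, b], c) + η([a, c], b) - η([b, c], a)`, where `ρ` is the anchor. -/
def algDiff (h : IsWeaklyIntegrable τ) (η : ∀ x : M, LinearMap.BilinForm ℝ (image τ x))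
    (a b c : imageSections τ) (x : M) : ℝ :=
  mvfderiv (𝓡 m) (evalForm η b c) x (anchor a x)
    - mvfderiv (𝓡 m) (evalForm η a c) x (anchor b x)
    + mvfderiv (𝓡 m) (evalForm η a b) x (anchor c x)
    - evalForm η (algBracket h a b) c x
    + evalForm η (algBracket h a c) b x
    - evalForm η (algBracket h b c) a x

/-- Symplectic forms of the Lie algebroid `E`: smooth, alternating, nondegenerate 2-forms `η` on
`E` with `d_E η = 0`. -/
structure IsSymplecticForm (h : IsWeaklyIntegrable τ)
    (η : ∀ x : M, LinearMap.BilinForm ℝ (image τ x)) : Prop where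
  smooth : ∀ a b : imageSections τ, ContMDiff (𝓡 m) 𝓘(ℝ, ℝ) ∞ (evalForm η a b)
  alt : ∀ x : M, (η x).IsAlt
  nondegenerate : ∀ x : M, (η x).Nondegenerate
  closed : ∀ (a b c : imageSections τ) (x : M), algDiff h η a b c x = 0

end Algebroid

end BigTangent

end

/-!
The Courant bracket is skew and compatible with the neutral metric: if `g(e, s) = 0`, then
`ρ(e) g(s, t) = g([e, s], t) + g([e, t], s) + ½ ρ(s) g(e, t)`. The image of `τ` is isotropic, so for
`a = τ X`, `b = τ Y`, `c = τ Z` this computes the terms `ρ(b) g(a, Z)` and `ρ(c) g(a, Y)` of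
`d ω(a, b, c)`. As `g(c, Y) = -g(b, Z)`, all derivatives then cancel, and what is left is
`-g([b, c], X) - g([b, Z], a) + g([c, Y], a)`, which is `-g(X, N(Y, Z))` by skewness of `τ`.

The equivalence follows because `g` is nondegenerate and, the rank of `τ` being constant,
`τ : Γ(TM ⊕ T*M) → Γ E` is onto: smooth local lifts exist and are glued by a partition of unity.
-/

section ConstantRank

theorem exists_comp_comp_eq_id_of_finrank_range_eq {K V V' W : Type*} [Field K]
    [AddCommGroup V] [Module K V] [AddCommGroup V'] [Module K V'] [AddCommGroup W] [Module K W]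
    [FiniteDimensional K W] (T : V →ₗ[K] V') [FiniteDimensional K (LinearMap.range T)]
    (hT : Module.finrank K (LinearMap.range T) = Module.finrank K W) :
    ∃ (P : V' →ₗ[K] W) (Q : W →ₗ[K] V), P ∘ₗ T ∘ₗ Q = LinearMap.id := by
  let φ : LinearMap.range T ≃ₗ[K] W := .ofFinrankEq _ _ hT
  obtain ⟨P, hP⟩ := LinearMap.exists_extend φ.toLinearMap
  obtain ⟨S, hS⟩ := T.rangeRestrict.exists_rightInverse_of_surjective T.range_rangeRestrict
  refine ⟨P, S ∘ₗ φ.symm.toLinearMap, LinearMap.ext fun w => ?_⟩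
  calc P (T (S (φ.symm w)))
      = P (T.rangeRestrict (S (φ.symm w)) : V') := rfl
    _ = P (φ.symm w : V') := by rw [← LinearMap.comp_apply, hS, LinearMap.id_apply]
    _ = φ (φ.symm w) := LinearMap.congr_fun hP _
    _ = w := φ.apply_symm_apply w

theorem apply_apply_eq_of_mem_range {K V V' W : Type*} [Field K]
    [AddCommGroup V] [Module K V] [AddCommGroup V'] [Module K V'] [AddCommGroup W] [Module K W]
    [FiniteDimensional K W] {T : V →ₗ[K] V'} [FiniteDimensional K (LinearMap.range T)]
    (hT : Module.finrank K (LinearMap.range T) = Module.finrank K W)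
    {P : V' →ₗ[K] W} {S : W → V} (hS : ∀ w, P (T (S w)) = w)
    {v : V'} (hv : v ∈ LinearMap.range T) : T (S (P v)) = v := by
  have hsurj : Function.Surjective (P.domRestrict (LinearMap.range T)) :=
    fun w => ⟨⟨T (S w), S w, rfl⟩, hS w⟩
  have hinj : Function.Injective (P.domRestrict (LinearMap.range T)) :=
    (LinearMap.injective_iff_surjective_of_finrank_eq_finrank hT).2 hsurj
  exact congrArg Subtype.val
    (@hinj ⟨T (S (P v)), S (P v), rfl⟩ ⟨v, hv⟩ (hS (P v)))

variable {𝕜 : Type*} [NontriviallyNormedField 𝕜]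
  {E : Type*} [NormedAddCommGroup E] [NormedSpace 𝕜 E] {H : Type*} [TopologicalSpace H]
  {I : ModelWithCorners 𝕜 E H} {M : Type*} [TopologicalSpace M] [ChartedSpace H M]
  {F : Type*} [NormedAddCommGroup F] [NormedSpace 𝕜 F]
  {V : M → Type*} [TopologicalSpace (TotalSpace F V)] [∀ x, AddCommGroup (V x)]
  [∀ x, Module 𝕜 (V x)] [∀ x, TopologicalSpace (V x)] [FiberBundle F V] [VectorBundle 𝕜 F V]
  {F' : Type*} [NormedAddCommGroup F'] [NormedSpace 𝕜 F']
  {V' : M → Type*} [TopologicalSpace (TotalSpace F' V')] [∀ x, AddCommGroup (V' x)]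
  [∀ x, Module 𝕜 (V' x)] [∀ x, TopologicalSpace (V' x)] [FiberBundle F' V'] [VectorBundle 𝕜 F' V']

theorem exists_comp_inCoordinates_comp_eq_one [CompleteSpace 𝕜] [FiniteDimensional 𝕜 F']
    {W : Type*} [NormedAddCommGroup W] [NormedSpace 𝕜 W] [FiniteDimensional 𝕜 W] {x : M}
    (T : V x →L[𝕜] V' x)
    (hT : Module.finrank 𝕜 (LinearMap.range (T : V x →ₗ[𝕜] V' x)) = Module.finrank 𝕜 W) :
    ∃ (P : F' →L[𝕜] W) (Q : W →L[𝕜] F),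
      P ∘L ContinuousLinearMap.inCoordinates F V F' V' x x x x T ∘L Q = 1 := by
  let e := trivializationAt F V x
  let e' := trivializationAt F' V' x
  have := VectorBundle.finiteDimensional 𝕜 F' V' x
  obtain ⟨P, Q, hPQ⟩ := exists_comp_comp_eq_id_of_finrank_range_eq (T : V x →ₗ[𝕜] V' x) hT
  refine ⟨(P ∘ₗ (e'.symmL 𝕜 x).toLinearMap).toContinuousLinearMap,
    ((e.continuousLinearMapAt 𝕜 x).toLinearMap ∘ₗ Q).toContinuousLinearMap,
    ContinuousLinearMap.ext fun w => ?_⟩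
  calc P (e'.symmL 𝕜 x (e'.continuousLinearMapAt 𝕜 x
        (T (e.symmL 𝕜 x (e.continuousLinearMapAt 𝕜 x (Q w))))))
      = P (T (Q w)) := by
        rw [e.symmL_continuousLinearMapAt (FiberBundle.mem_baseSet_trivializationAt' x),
          e'.symmL_continuousLinearMapAt (FiberBundle.mem_baseSet_trivializationAt' x)]
    _ = w := LinearMap.congr_fun hPQ w

variable [∀ x, IsTopologicalAddGroup (V' x)] [∀ x, ContinuousSMul 𝕜 (V' x)]
  {n : WithTop ℕ∞} [ContMDiffVectorBundle n F V I] [ContMDiffVectorBundle n F' V' I]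
  {τ : ∀ x, V x →L[𝕜] V' x} {a : ∀ x, V' x}

theorem contMDiffOn_inCoordinates
    (hτ : CMDiff n (fun x => TotalSpace.mk' (F →L[𝕜] F') (E := fun x => V x →L[𝕜] V' x) x (τ x)))
    (x : M) :
    CMDiff[(trivializationAt F V x).baseSet ∩ (trivializationAt F' V' x).baseSet] n
      (fun y => ContinuousLinearMap.inCoordinates F V F' V' x y x y (τ y)) :=
  (Trivialization.contMDiffOn_section_baseSet_iff (IB := I) (n := n) (s := τ)
    (trivializationAt (F →L[𝕜] F') (fun y : M => V y →L[𝕜] V' y) x)).1 hτ.contMDiffOn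

theorem contMDiffOn_ringInverse {R : Type*} [NormedRing R] [HasSummableGeomSeries R]
    [NormedAlgebra 𝕜 R] {c : M → R} {s : Set M} (hc : ContMDiffOn I 𝓘(𝕜, R) n c s)
    (hs : ∀ y ∈ s, IsUnit (c y)) :
    ContMDiffOn I 𝓘(𝕜, R) n (fun y => Ring.inverse (c y)) s := fun y hy => by
  obtain ⟨A, hA⟩ := hs y hy
  have hinv : ContDiffAt 𝕜 n Ring.inverse (c y) := hA ▸ contDiffAt_ringInverse 𝕜 A
  exact hinv.contMDiffAt.comp_contMDiffWithinAt y (hc y hy)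

theorem contMDiffOn_symmL {e : Trivialization F (TotalSpace.proj : TotalSpace F V → M)}
    [MemTrivializationAtlas e] {f : M → F} {s : Set M} (hf : CMDiff[s] n f) (hs : s ⊆ e.baseSet) :
    CMDiff[s] n (T% fun y => e.symmL 𝕜 y (f y)) := fun y hy => by
  have heq (z : M) (hz : z ∈ s) : (e ⟨z, e.symmL 𝕜 z (f z)⟩).2 = f z := by
    rw [e.symmL_apply (hs hz), e.apply_mk_symm (hs hz)]
  exact (e.contMDiffWithinAt_section _ (hs hy)).2 ((hf y hy).congr heq (heq y hy))

theorem exists_contMDiffOn_lift [CompleteSpace 𝕜] [FiniteDimensional 𝕜 F']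
    (hτ : CMDiff n (fun x => TotalSpace.mk' (F →L[𝕜] F') (E := fun x => V x →L[𝕜] V' x) x (τ x)))
    {x : M} (hrank : ∀ᶠ y in 𝓝 x, Module.finrank 𝕜 (LinearMap.range (τ y : V y →ₗ[𝕜] V' y)) =
      Module.finrank 𝕜 (LinearMap.range (τ x : V x →ₗ[𝕜] V' x)))
    (ha : CMDiff n (T% a)) (haτ : ∀ y, a y ∈ LinearMap.range (τ y : V y →ₗ[𝕜] V' y)) :
    ∃ U ∈ 𝓝 x, ∃ s : ∀ y, V y, CMDiff[U] n (T% s) ∧ ∀ y ∈ U, τ y (s y) = a y := by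
  let W := Fin (Module.finrank 𝕜 (LinearMap.range (τ x : V x →ₗ[𝕜] V' x))) → 𝕜
  have hW : Module.finrank 𝕜 W = Module.finrank 𝕜 (LinearMap.range (τ x : V x →ₗ[𝕜] V' x)) :=
    Module.finrank_fin_fun 𝕜
  obtain ⟨P, Q, hPQ⟩ := exists_comp_inCoordinates_comp_eq_one (F := F) (F' := F') (τ x) hW.symm
  let e := trivializationAt F V x
  let e' := trivializationAt F' V' x
  let B := e.baseSet ∩ e'.baseSet
  let c : M → (W →L[𝕜] W) :=
    fun y => P ∘L ContinuousLinearMap.inCoordinates F V F' V' x y x y (τ y) ∘L Q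
  have hB : IsOpen B := e.open_baseSet.inter e'.open_baseSet
  have hc : CMDiff[B] n c :=
    contMDiffOn_const.clm_comp ((contMDiffOn_inCoordinates hτ x).clm_comp contMDiffOn_const)
  let U := B ∩ c ⁻¹' {A | IsUnit A}
  have hU : U ∈ 𝓝 x := (hc.continuousOn.isOpen_inter_preimage hB Units.isOpen).mem_nhds
    ⟨⟨FiberBundle.mem_baseSet_trivializationAt' x, FiberBundle.mem_baseSet_trivializationAt' x⟩,
      by simp [c, hPQ]⟩
  have ha' : CMDiff[U] n (fun y => e'.continuousLinearMapAt 𝕜 y (a y)) :=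
    ((e'.contMDiffOn_section_baseSet_iff.1 ha.contMDiffOn).mono fun y hy => hy.1.2).congr
      fun y hy => e'.continuousLinearMapAt_apply_of_mem 𝕜 hy.1.2 (a y)
  have hinv : CMDiff[U] n (fun y => Ring.inverse (c y)) :=
    contMDiffOn_ringInverse (hc.mono Set.inter_subset_left) fun y hy => hy.2
  -- As `P` is injective on `range (τ y)` where the rank is that at `x`, the section
  -- `s = Q (P τ Q)⁻¹ P a` solves `τ s = a` because `P τ s = P a`.
  refine ⟨_, Filter.inter_mem hU hrank,
    fun y => e.symmL 𝕜 y (Q (Ring.inverse (c y) (P (e'.continuousLinearMapAt 𝕜 y (a y))))),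
    ?_, fun y ⟨⟨_, hcy⟩, hy⟩ => ?_⟩
  · exact (contMDiffOn_symmL (contMDiffOn_const.clm_apply (hinv.clm_apply
      (contMDiffOn_const.clm_apply ha'))) fun y hy => hy.1.1).mono Set.inter_subset_left
  · have := VectorBundle.finiteDimensional 𝕜 F' V' y
    exact apply_apply_eq_of_mem_range (hy.trans hW.symm)
      (P := P.toLinearMap ∘ₗ (e'.continuousLinearMapAt 𝕜 y).toLinearMap)
      (S := fun w => e.symmL 𝕜 y (Q (Ring.inverse (c y) w)))
      (DFunLike.congr_fun (Ring.mul_inverse_cancel (c y) hcy)) (haτ y)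

end ConstantRank

section GlobalSections

variable {E : Type*} [NormedAddCommGroup E] [NormedSpace ℝ E] [FiniteDimensional ℝ E]
  {H : Type*} [TopologicalSpace H] {I : ModelWithCorners ℝ E H}
  {M : Type*} [TopologicalSpace M] [T2Space M] [ChartedSpace H M] [IsManifold I ∞ M]
  {F : Type*} [NormedAddCommGroup F] [NormedSpace ℝ F]
  {V : M → Type*} [TopologicalSpace (TotalSpace F V)] [∀ x, AddCommGroup (V x)]
  [∀ x, Module ℝ (V x)] [∀ x, TopologicalSpace (V x)] [FiberBundle F V] [VectorBundle ℝ F V]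

theorem exists_contMDiffSection_apply_eq [ContMDiffVectorBundle ∞ F V I] {x : M} (v : V x) :
    ∃ s : Cₛ^∞⟮I; F, V⟯, s x = v := by
  obtain ⟨U, hU, hs⟩ := FiberBundle.exists_contMDiffOn_extend (k := ∞) I F v
  obtain ⟨f, -, hf⟩ :=
    (SmoothBumpFunction.nhds_basis_tsupport (I := I) x).mem_iff.1 (interior_mem_nhds.2 hU)
  refine ⟨⟨(f : M → ℝ) • FiberBundle.extend F v, f.contMDiff.contMDiffOn.smul_section_of_tsupport
    isOpen_interior hf (hs.mono interior_subset)⟩, ?_⟩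
  change f x • FiberBundle.extend F v x = v
  rw [f.eq_one, one_smul, FiberBundle.extend_apply_self]

variable [SigmaCompactSpace M] {F' : Type*} [NormedAddCommGroup F'] [NormedSpace ℝ F']
  [FiniteDimensional ℝ F'] {V' : M → Type*} [TopologicalSpace (TotalSpace F' V')]
  [∀ x, AddCommGroup (V' x)] [∀ x, Module ℝ (V' x)] [∀ x, TopologicalSpace (V' x)]
  [∀ x, IsTopologicalAddGroup (V' x)] [∀ x, ContinuousSMul ℝ (V' x)] [FiberBundle F' V']
  [VectorBundle ℝ F' V'] {n : ℕ∞} [ContMDiffVectorBundle n F V I] [ContMDiffVectorBundle n F' V' I]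

theorem exists_contMDiffSection_lift {τ : ∀ x, V x →L[ℝ] V' x}
    (hτ : CMDiff n (fun x => TotalSpace.mk' (F →L[ℝ] F') (E := fun x => V x →L[ℝ] V' x) x (τ x)))
    (hr : IsLocallyConstant fun x => Module.finrank ℝ (LinearMap.range (τ x : V x →ₗ[ℝ] V' x)))
    {a : ∀ x, V' x} (ha : CMDiff n (T% a))
    (haτ : ∀ x, a x ∈ LinearMap.range (τ x : V x →ₗ[ℝ] V' x)) :
    ∃ s : Cₛ^n⟮I; F, V⟯, ∀ x, τ x (s x) = a x :=
  exists_contMDiffSection_forall_mem_convex_of_local I V (fun x => {v | τ x v = a x})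
    (fun x => (convex_singleton (a x)).linear_preimage (τ x : V x →ₗ[ℝ] V' x))
    fun x => exists_contMDiffOn_lift hτ (hr.eventually_eq x) ha haτ

end GlobalSections

namespace BigTangent

variable {m : ℕ} {M : Type*} [TopologicalSpace M] [ChartedSpace (EuclideanSpace ℝ (Fin m)) M]

section Neutral

variable {x : M}

theorem neutral_comm (u v : Big m M x) : neutral u v = neutral v u := add_comm _ _

theorem neutral_sub_right (u v v' : Big m M x) :
    neutral u (v - v') = neutral u v - neutral u v' := by
  simp only [neutral, Prod.fst_sub, Prod.snd_sub, map_sub, sub_apply]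
  ring

theorem neutral_neg_left (u v : Big m M x) : neutral (-u) v = -neutral u v := by
  simp only [neutral, Prod.fst_neg, Prod.snd_neg, map_neg, neg_apply]
  ring

theorem eq_zero_of_forall_neutral {u : Big m M x} (h : ∀ v, neutral u v = 0) : u = 0 := by
  have htan (f : Cot m M x) : f u.1 = 0 := by simpa [neutral] using h (0, f)
  have hcot (v : Tan m M x) : u.2 v = 0 := by simpa [neutral] using h (v, 0)
  exact Prod.ext (SeparatingDual.eq_zero_of_forall_dual_eq_zero (R := ℝ) (V := Mod m) htan)
    (ContinuousLinearMap.ext hcot)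

end Neutral

variable [IsManifold (𝓡 m) ∞ M]

section Courant

theorem bracket_swap (X Y : VecField m M) : bracket Y X = -bracket X Y :=
  ContMDiffSection.ext fun _ => mlieBracket_swap_apply

theorem lieDeriv_apply (X Z : VecField m M) (μ : OneForm m M) (x : M) :
    lieDeriv X μ x (Z x) = mvfderiv (𝓡 m) (pair μ Z) x (X x) - pair μ (bracket X Z) x :=
  lieDerivAt_apply X μ Z.mdifferentiableAt

theorem differential_sub (f g : SmoothFun m M) :
    differential (f - g) = differential f - differential g :=
  ContMDiffSection.ext fun _ => mvfderiv_fun_sub f.mdifferentiableAt g.mdifferentiableAt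

theorem courant_swap (s t : BigSection m M) : courant t s = -courant s t := by
  have hcot : lieDeriv (prTan t) (prCot s) - lieDeriv (prTan s) (prCot t)
        + (1 / 2 : ℝ) • differential (pair (prCot t) (prTan s) - pair (prCot s) (prTan t))
      = -(lieDeriv (prTan s) (prCot t) - lieDeriv (prTan t) (prCot s)
        + (1 / 2 : ℝ) • differential (pair (prCot s) (prTan t) - pair (prCot t) (prTan s))) := by
    rw [differential_sub, differential_sub]
    module
  exact ContMDiffSection.ext fun x => Prod.ext
    (DFunLike.congr_fun (bracket_swap (prTan s) (prTan t)) x) (DFunLike.congr_fun hcot x)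

theorem contMDiff_neutral (s t : BigSection m M) :
    ContMDiff (𝓡 m) 𝓘(ℝ, ℝ) ∞ (fun x => neutral (s x) (t x)) :=
  (pair (prCot s) (prTan t) + pair (prCot t) (prTan s)).contMDiff

theorem mvfderiv_neutral (s t : BigSection m M) (x : M) (v : Tan m M x) :
    mvfderiv (𝓡 m) (fun y => neutral (s y) (t y)) x v
      = mvfderiv (𝓡 m) (pair (prCot s) (prTan t)) x v
        + mvfderiv (𝓡 m) (pair (prCot t) (prTan s)) x v :=
  DFunLike.congr_fun (mvfderiv_fun_add (pair (prCot s) (prTan t)).mdifferentiableAt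
    (pair (prCot t) (prTan s)).mdifferentiableAt) v

theorem neutral_courant (e s t : BigSection m M) (x : M) :
    neutral (courant e s x) (t x)
      = mvfderiv (𝓡 m) (pair (prCot s) (prTan t)) x (prTan e x)
        - mvfderiv (𝓡 m) (pair (prCot e) (prTan t)) x (prTan s x)
        + 1 / 2 * (mvfderiv (𝓡 m) (pair (prCot e) (prTan s)) x (prTan t x)
          - mvfderiv (𝓡 m) (pair (prCot s) (prTan e)) x (prTan t x))
        - pair (prCot s) (bracket (prTan e) (prTan t)) x
        + pair (prCot e) (bracket (prTan s) (prTan t)) x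
        + pair (prCot t) (bracket (prTan e) (prTan s)) x := by
  have hd := DFunLike.congr_fun (differential_sub (pair (prCot e) (prTan s))
    (pair (prCot s) (prTan e))) x
  calc neutral (courant e s x) (t x)
      = lieDeriv (prTan e) (prCot s) x (prTan t x) - lieDeriv (prTan s) (prCot e) x (prTan t x)
        + 1 / 2 * differential (pair (prCot e) (prTan s) - pair (prCot s) (prTan e)) x (prTan t x)
        + pair (prCot t) (bracket (prTan e) (prTan s)) x := rfl
    _ = _ := by
      rw [lieDeriv_apply, lieDeriv_apply, hd]
      change _ + 1 / 2 * (mvfderiv (𝓡 m) (pair (prCot e) (prTan s)) x (prTan t x)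
        - mvfderiv (𝓡 m) (pair (prCot s) (prTan e)) x (prTan t x)) + _ = _
      ring

theorem mvfderiv_neutral_eq_courant (e s t : BigSection m M) (x : M) :
    mvfderiv (𝓡 m) (fun y => neutral (s y) (t y)) x (prTan e x)
      = neutral (courant e s x) (t x) + neutral (courant e t x) (s x)
        + 1 / 2 * mvfderiv (𝓡 m) (fun y => neutral (e y) (s y)) x (prTan t x)
        + 1 / 2 * mvfderiv (𝓡 m) (fun y => neutral (e y) (t y)) x (prTan s x) := by
  have hb : pair (prCot e) (bracket (prTan t) (prTan s)) x
      = -pair (prCot e) (bracket (prTan s) (prTan t)) x := by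
    rw [bracket_swap]
    exact map_neg (prCot e x) _
  simp only [neutral_courant, mvfderiv_neutral, hb]
  ring

theorem mvfderiv_neutral_of_orthogonal {e s : BigSection m M} (h : ∀ y, neutral (e y) (s y) = 0)
    (t : BigSection m M) (x : M) :
    mvfderiv (𝓡 m) (fun y => neutral (s y) (t y)) x (prTan e x)
      = neutral (courant e s x) (t x) + neutral (courant e t x) (s x)
        + 1 / 2 * mvfderiv (𝓡 m) (fun y => neutral (e y) (t y)) x (prTan s x) := by
  rw [mvfderiv_neutral_eq_courant, funext h, mvfderiv_const, zero_apply, mul_zero, add_zero]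

theorem neutral_courant_swap (s t : BigSection m M) {x : M} (u : Big m M x) :
    neutral (courant t s x) u = -neutral (courant s t x) u := by
  rw [courant_swap s t, ContMDiffSection.coe_neg, Pi.neg_apply, neutral_neg_left]

end Courant

section Torsion

variable {τ : BigEndo m M} {x : M}

theorem IsTwoNilpotent.neutral_apply_right (hτ : IsTwoNilpotent τ) (u v : Big m M x) :
    neutral u (τ x v) = -neutral (τ x u) v :=
  eq_neg_of_add_eq_zero_left (hτ.skew x u v)

theorem IsTwoNilpotent.neutral_apply_apply (hτ : IsTwoNilpotent τ) (u v : Big m M x) :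
    neutral (τ x u) (τ x v) = 0 := by
  rw [hτ.neutral_apply_right, hτ.sq_zero]
  simp [neutral]

theorem IsTwoNilpotent.isLocallyConstant_finrank (hτ : IsTwoNilpotent τ) :
    IsLocallyConstant fun x => Module.finrank ℝ (image τ x) :=
  let ⟨_, hr⟩ := hτ.const_rank
  .of_constant _ fun x y => (hr x).trans (hr y).symm

theorem omega_isAlt (hτ : IsTwoNilpotent τ) (x : M) : (omega hτ x).IsAlt := by
  rintro ⟨_, u, rfl⟩
  have hskew : neutral (τ x u) u = -neutral (τ x u) u := by
    rw [← hτ.neutral_apply_right, neutral_comm]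
  exact (omega_apply hτ _ _ rfl).trans (self_eq_neg.1 hskew)

theorem omega_nondegenerate (hτ : IsTwoNilpotent τ) (x : M) : (omega hτ x).Nondegenerate :=
  (LinearMap.IsAlt.isRefl (omega_isAlt hτ x)).nondegenerate_iff_separatingLeft.2 fun e he =>
    Subtype.ext <| eq_zero_of_forall_neutral fun u =>
      (omega_apply hτ e ⟨τ x u, u, rfl⟩ rfl).symm.trans (he _)

theorem evalForm_omega_applyImage (hτ : IsTwoNilpotent τ) (a : imageSections τ)
    (t : BigSection m M) :
    evalForm (omega hτ) a (applyImage τ t) = fun x => neutral (a.1 x) (t x) :=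
  funext fun _ => omega_apply hτ _ _ rfl

theorem neutral_torsion (hτ : IsTwoNilpotent τ) (X Y Z : BigSection m M) (x : M) :
    neutral (X x) (torsion τ Y Z x)
      = neutral (courant (apply τ Y) (apply τ Z) x) (X x)
        + neutral (courant Y (apply τ Z) x) (apply τ X x)
        + neutral (courant (apply τ Y) Z x) (apply τ X x) := by
  calc neutral (X x) (torsion τ Y Z x)
      = neutral (X x) (courant (apply τ Y) (apply τ Z) x - τ x (courant Y (apply τ Z) x)
          - τ x (courant (apply τ Y) Z x) + τ x (τ x (courant Y Z x))) := rfl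
    _ = neutral (X x) (courant (apply τ Y) (apply τ Z) x)
        + neutral (τ x (X x)) (courant Y (apply τ Z) x)
        + neutral (τ x (X x)) (courant (apply τ Y) Z x) := by
      rw [hτ.sq_zero, add_zero, neutral_sub_right, neutral_sub_right, hτ.neutral_apply_right,
        hτ.neutral_apply_right, sub_neg_eq_add, sub_neg_eq_add]
    _ = _ := by
      simp only [neutral_comm (X x), neutral_comm (τ x (X x))]
      rfl

theorem algDiff_omega_applyImage (hτ : IsTwoNilpotent τ) (h : IsWeaklyIntegrable τ)
    (X Y Z : BigSection m M) (x : M) :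
    algDiff h (omega hτ) (applyImage τ X) (applyImage τ Y) (applyImage τ Z) x
      = mvfderiv (𝓡 m) (fun y => neutral (apply τ Y y) (Z y)) x (prTan (apply τ X) x)
        - mvfderiv (𝓡 m) (fun y => neutral (apply τ X y) (Z y)) x (prTan (apply τ Y) x)
        + mvfderiv (𝓡 m) (fun y => neutral (apply τ X y) (Y y)) x (prTan (apply τ Z) x)
        - neutral (courant (apply τ X) (apply τ Y) x) (Z x)
        + neutral (courant (apply τ X) (apply τ Z) x) (Y x)
        - neutral (courant (apply τ Y) (apply τ Z) x) (X x) := by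
  simp only [algDiff, evalForm_omega_applyImage]
  rfl

theorem algDiff_omega_eq_neg_neutral_torsion (hτ : IsTwoNilpotent τ) (h : IsWeaklyIntegrable τ)
    (X Y Z : BigSection m M) (x : M) :
    algDiff h (omega hτ) (applyImage τ X) (applyImage τ Y) (applyImage τ Z) x
      = -neutral (X x) (torsion τ Y Z x) := by
  have hY := mvfderiv_neutral_of_orthogonal (e := apply τ Y) (s := apply τ X)
    (fun y => hτ.neutral_apply_apply _ _) Z x
  have hZ := mvfderiv_neutral_of_orthogonal (e := apply τ Z) (s := apply τ X)
    (fun y => hτ.neutral_apply_apply _ _) Y x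
  have hd : mvfderiv (𝓡 m) (fun y => neutral (apply τ Z y) (Y y)) x (prTan (apply τ X) x)
      = -mvfderiv (𝓡 m) (fun y => neutral (apply τ Y y) (Z y)) x (prTan (apply τ X) x) := by
    have hskew (y : M) : neutral (apply τ Z y) (Y y) = -neutral (apply τ Y y) (Z y) :=
      (neutral_comm _ _).trans (hτ.neutral_apply_right _ _)
    rw [funext hskew]
    exact DFunLike.congr_fun (mvfderiv_neg (g := fun y => neutral (apply τ Y y) (Z y))) _
  rw [algDiff_omega_applyImage, neutral_torsion hτ, hY, hZ, hd,
    neutral_courant_swap (apply τ X) (apply τ Y), neutral_courant_swap (apply τ X) (apply τ Z),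
    neutral_courant_swap Y (apply τ Z)]
  ring

end Torsion

section Integrability

variable [T2Space M] {τ : BigEndo m M}

theorem applyImage_surjective [SigmaCompactSpace M]
    (hr : IsLocallyConstant fun x => Module.finrank ℝ (image τ x)) :
    Function.Surjective (applyImage τ) := fun a => by
  obtain ⟨s, hs⟩ := exists_contMDiffSection_lift (n := ⊤) τ.contMDiff hr a.1.contMDiff a.2
  exact ⟨s, Subtype.ext (ContMDiffSection.ext hs)⟩

theorem isWeaklyIntegrable_of_isIntegrable [SigmaCompactSpace M]
    (hr : IsLocallyConstant fun x => Module.finrank ℝ (image τ x)) (h : IsIntegrable τ) :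
    IsWeaklyIntegrable τ := fun a ha b hb x => by
  obtain ⟨s, hs⟩ := applyImage_surjective hr ⟨a, ha⟩
  obtain ⟨t, ht⟩ := applyImage_surjective hr ⟨b, hb⟩
  obtain rfl : apply τ s = a := congrArg Subtype.val hs
  obtain rfl : apply τ t = b := congrArg Subtype.val ht
  have htorsion : courant (apply τ s) (apply τ t) x - τ x (courant s (apply τ t) x)
      - τ x (courant (apply τ s) t x) + τ x (τ x (courant s t x)) = 0 :=
    DFunLike.congr_fun (h s t) x
  have hsum : courant (apply τ s) (apply τ t) x = τ x (courant s (apply τ t) x)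
      + τ x (courant (apply τ s) t x) - τ x (τ x (courant s t x)) :=
    sub_eq_zero.1 (Eq.trans (by abel) htorsion)
  rw [hsum]
  exact sub_mem (add_mem ⟨_, rfl⟩ ⟨_, rfl⟩) ⟨_, rfl⟩

theorem isSymplecticForm_omega [SigmaCompactSpace M] (hτ : IsTwoNilpotent τ) (h : IsIntegrable τ)
    (hw : IsWeaklyIntegrable τ) : IsSymplecticForm hw (omega hτ) where
  smooth a b := by
    obtain ⟨t, rfl⟩ := applyImage_surjective hτ.isLocallyConstant_finrank b
    rw [evalForm_omega_applyImage]
    exact contMDiff_neutral a.1 t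
  alt := omega_isAlt hτ
  nondegenerate := omega_nondegenerate hτ
  closed a b c x := by
    obtain ⟨X, rfl⟩ := applyImage_surjective hτ.isLocallyConstant_finrank a
    obtain ⟨Y, rfl⟩ := applyImage_surjective hτ.isLocallyConstant_finrank b
    obtain ⟨Z, rfl⟩ := applyImage_surjective hτ.isLocallyConstant_finrank c
    rw [algDiff_omega_eq_neg_neutral_torsion, h Y Z]
    simp [neutral]

theorem isIntegrable_of_algDiff_omega_eq_zero (hτ : IsTwoNilpotent τ) (hw : IsWeaklyIntegrable τ)
    (h : ∀ (a b c : imageSections τ) (x : M), algDiff hw (omega hτ) a b c x = 0) :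
    IsIntegrable τ := fun s t =>
  ContMDiffSection.ext fun x => eq_zero_of_forall_neutral fun u => by
    obtain ⟨X, rfl⟩ : ∃ X : BigSection m M, X x = u := exists_contMDiffSection_apply_eq u
    rw [neutral_comm, ← neg_eq_zero, ← algDiff_omega_eq_neg_neutral_torsion hτ hw X s t x]
    exact h _ _ _ x

end Integrability

end BigTangent

open BigTangent in
theorem proposition4p1 {m : ℕ} {M : Type*} [TopologicalSpace M] [T2Space M]
    [SecondCountableTopology M] [ChartedSpace (EuclideanSpace ℝ (Fin m)) M]
    [IsManifold (𝓡 m) ∞ M] (τ : BigEndo m M) (hτ : IsTwoNilpotent τ) :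
    (IsIntegrable τ ↔ ∃ h : IsWeaklyIntegrable τ, IsSymplecticForm h (omega hτ)) ∧
      ∀ (h : IsWeaklyIntegrable τ) (X Y Z : BigSection m M) (x : M),
        algDiff h (omega hτ) (applyImage τ X) (applyImage τ Y) (applyImage τ Z) x
          = - neutral (X x) (torsion τ Y Z x) := by
  have : LocallyCompactSpace M := ChartedSpace.locallyCompactSpace (EuclideanSpace ℝ (Fin m)) M
  refine ⟨⟨fun h => ?_, fun ⟨hw, hω⟩ => ?_⟩, algDiff_omega_eq_neg_neutral_torsion hτ⟩
  · have hw := isWeaklyIntegrable_of_isIntegrable hτ.isLocallyConstant_finrank h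
    exact ⟨hw, isSymplecticForm_omega hτ h hw⟩
  · exact isIntegrable_of_algDiff_omega_eq_zero hτ hw hω.closed
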